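/- For integers $n\ge 0$, $s\ge 4$ even, and $t\ge 2$, let $C_s^t(n)$ denote the number of partitions of $n$ in which no part is congruent to any of $2,4,6,\dots,s-2$ modulo $s$ and every part appears fewer than $t$ times. For integers $0<i\le k$ and $n\ge 0$, let $V_{k,i}(n)$ denote the number of partitions of $n$ into parts not congruent to $2$ modulo $4$ and not congruent to $0,\pm(2i-1)$ modulo $4k$. Let $W_{k,i}(n)$ denote the number of partitions $\lambda_1\ge\lambda_2\ge\dots\ge\lambda_m$ of $n$ (parts listed with multiplicity) such that no odd part is repeated; for every $j$ with $1\le j$ and $j+k-1\le m$, one has $\lambda_j-\lambda_{j+k-1}\ge 2$ if $\lambda_j$ is odd and $\lambda_j-\lambda_{j+k-1}>2$ if $\lambda_j$ is even; and at most $i-1$ of the parts (counted with multiplicity) are $\le 2$. Then for every odd integer $t\ge 3$ and every integer $n\ge 0$, $$C_4^t(n)=V_{t,(t+1)/2}(n)=W_{t,(t+1)/2}(n).$$ -/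

import Mathlib

/-- A partition is `s`-congruent if no part is congruent to one of `2, 4, 6, …, s - 2`
modulo `s`. -/
def IsSCongruent (s : ℕ) {n : ℕ} (p : Nat.Partition n) : Prop :=
  ∀ a ∈ p.parts, ∀ r : ℕ, 0 < r → 2 * r < s → ¬ a ≡ 2 * r [MOD s]

/-- A partition is `t`-distinct if every part appears fewer than `t` times. -/
def IsTDistinct (t : ℕ) {n : ℕ} (p : Nat.Partition n) : Prop :=
  ∀ a ∈ p.parts, p.parts.count a < t

/-- The partitions counted by `V_{k,i}(n)`: no part is congruent to `2` modulo `4`, and no part is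
congruent to `0`, `2i - 1` or `-(2i - 1)` modulo `4k`. -/
def IsVPartition (k i : ℕ) {n : ℕ} (p : Nat.Partition n) : Prop :=
  ∀ a ∈ p.parts,
    ¬ a ≡ 2 [MOD 4] ∧
    ¬ (a : ℤ) ≡ 0 [ZMOD 4 * (k : ℤ)] ∧
    ¬ (a : ℤ) ≡ 2 * (i : ℤ) - 1 [ZMOD 4 * (k : ℤ)] ∧
    ¬ (a : ℤ) ≡ -(2 * (i : ℤ) - 1) [ZMOD 4 * (k : ℤ)]

/-- The parts of a partition, with multiplicity, listed in weakly decreasing order. -/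
def partsList {n : ℕ} (p : Nat.Partition n) : List ℕ :=
  p.parts.sort (· ≥ ·)

/-- The partitions counted by `W_{k,i}(n)` (for `0 < i ≤ k`). With the parts, repeated according
to multiplicity, written as `l₀ ≥ l₁ ≥ …`: no odd part is repeated; whenever both `l_j` and
`l_{j+k-1}` exist, `l_j - l_{j+k-1} ≥ 2` if `l_j` is odd and `l_j - l_{j+k-1} > 2` if `l_j` is
even; and at most `i - 1` parts, counted with multiplicity, are `≤ 2`. -/
def IsWPartition (k i : ℕ) {n : ℕ} (p : Nat.Partition n) : Prop :=
  (∀ a ∈ p.parts, Odd a → p.parts.count a = 1) ∧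
  (∀ (j : ℕ) (h : j + (k - 1) < (partsList p).length),
    (Odd ((partsList p)[j]) → 2 ≤ (partsList p)[j] - (partsList p)[j + (k - 1)]) ∧
    (Even ((partsList p)[j]) → 2 < (partsList p)[j] - (partsList p)[j + (k - 1)])) ∧
  (p.parts.filter (fun a => a ≤ 2)).card ≤ i - 1

open Classical in
/-- `C_s^t(n)`: the number of partitions of `n` that are `s`-congruent and `t`-distinct. -/
noncomputable def countC (s t n : ℕ) : ℕ :=
  (Finset.univ.filter (fun p : Nat.Partition n => IsSCongruent s p ∧ IsTDistinct t p)).card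

open Classical in
/-- `V_{k,i}(n)`. -/
noncomputable def countV (k i n : ℕ) : ℕ :=
  (Finset.univ.filter (fun p : Nat.Partition n => IsVPartition k i p)).card

open Classical in
/-- `W_{k,i}(n)`. -/
noncomputable def countW (k i n : ℕ) : ℕ :=
  (Finset.univ.filter (fun p : Nat.Partition n => IsWPartition k i p)).card

/-! All three generating functions equal ∏ (1 - q^(t i)) / (1 - q^i) over i ≢ 2 (mod 4). For C each
factor is a finite geometric sum. For V the residues 0, ±t modulo 4t are the multiples of t other
than those ≡ 2t; as t is odd, the latter are ≡ 2 (mod 4) and already excluded. So V forbids exactly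
the multiples of t, whose factors cancel.

The depth lies in W. Put K = t - 1. Removing the parts 2m+1 and 2m+2 gives recurrences
(`isGGSystem_ggSet`) that Andrews' hypergeometric series also satisfy (`hyperJ_zero`,
`hyperJ_succ`). Both families are constant for large m, so descent in m identifies them up to the
factor (q²;q²)/(-q;q²) (`IsGGSystem.mul_eq_hyperJ`). At m = 0 the series is a theta series, and at
the middle index it is the k = 1 theta series in q^t (`thetaSum_middle`). Jacobi's triple product is
not needed: the constant system R = 1 with K = 0 evaluates the case k = 1 (`thetaSum_one`).

The algebra is done where q^N = 0, eventually in ℤ⟦X⟧/(X^N), so infinite products are finite and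
their denominators are units. -/

namespace GollnitzGordon

open Finset

/-! ### Andrews' hypergeometric series with nilpotent q -/

section Algebra

variable {A : Type*} [CommRing A]

/-- The finite product `(-q; q²)_n`. -/
def oddProd (q : A) (n : ℕ) : A := ∏ j ∈ range n, (1 + q ^ (2 * j + 1))

/-- The finite product `(q²; q²)_n`. -/
def evenProd (q : A) (n : ℕ) : A := ∏ j ∈ range n, (1 - q ^ (2 * j + 2))

lemma oddProd_succ (q : A) (n : ℕ) :
    oddProd q (n + 1) = oddProd q n * (1 + q ^ (2 * n + 1)) := prod_range_succ _ _

lemma evenProd_succ (q : A) (n : ℕ) :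
    evenProd q (n + 1) = evenProd q n * (1 - q ^ (2 * n + 2)) := prod_range_succ _ _

lemma isUnit_one_sub_pow {q : A} (hq : IsNilpotent q) (n : ℕ) : IsUnit (1 - q ^ (n + 1)) :=
  (hq.pow_succ n).isUnit_one_sub

lemma isUnit_one_add_pow {q : A} (hq : IsNilpotent q) (n : ℕ) : IsUnit (1 + q ^ (n + 1)) :=
  (hq.pow_succ n).isUnit_one_add

lemma isUnit_oddProd {q : A} (hq : IsNilpotent q) (n : ℕ) : IsUnit (oddProd q n) := by
  induction n with
  | zero => simp [oddProd]
  | succ n ih => rw [oddProd_succ]; exact ih.mul (isUnit_one_add_pow hq _)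

lemma isUnit_evenProd {q : A} (hq : IsNilpotent q) (n : ℕ) : IsUnit (evenProd q n) := by
  induction n with
  | zero => simp [evenProd]
  | succ n ih => rw [evenProd_succ]; exact ih.mul (isUnit_one_sub_pow hq (2 * n + 1))

lemma oddProd_of_le {q : A} {N : ℕ} (hq : q ^ N = 0) {n : ℕ} (hn : N ≤ n) :
    oddProd q n = oddProd q N := by
  induction n, hn using Nat.le_induction with
  | base => rfl
  | succ n hn ih => rw [oddProd_succ, ih, pow_eq_zero_of_le (by omega) hq, add_zero, mul_one]

lemma evenProd_of_le {q : A} {N : ℕ} (hq : q ^ N = 0) {n : ℕ} (hn : N ≤ n) :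
    evenProd q n = evenProd q N := by
  induction n, hn using Nat.le_induction with
  | base => rfl
  | succ n hn ih => rw [evenProd_succ, ih, pow_eq_zero_of_le (by omega) hq, sub_zero, mul_one]

/-- The quotient `(-q; q²)_n (q²; q²)_{m+n} / ((q²; q²)_n (-q; q²)_{m+1+n})`. -/
noncomputable def hyperCoeff (q : A) (m n : ℕ) : A :=
  oddProd q n * evenProd q (m + n) *
    (Ring.inverse (evenProd q n) * Ring.inverse (oddProd q (m + 1 + n)))

lemma hyperCoeff_mul {q : A} (hq : IsNilpotent q) (m n : ℕ) :
    hyperCoeff q m n * (evenProd q n * oddProd q (m + 1 + n)) =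
      oddProd q n * evenProd q (m + n) := by
  have h1 := Ring.inverse_mul_cancel _ (isUnit_evenProd hq n)
  have h2 := Ring.inverse_mul_cancel _ (isUnit_oddProd hq (m + 1 + n))
  unfold hyperCoeff
  linear_combination oddProd q n * evenProd q (m + n) *
    (Ring.inverse (oddProd q (m + 1 + n)) * oddProd q (m + 1 + n)) * h1 +
    oddProd q n * evenProd q (m + n) * h2

lemma hyperCoeff_succ_left {q : A} (hq : IsNilpotent q) (m n : ℕ) :
    hyperCoeff q (m + 1) n * (1 + q ^ (2 * m + 2 * n + 3)) =
      hyperCoeff q m n * (1 - q ^ (2 * m + 2 * n + 2)) := by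
  refine ((isUnit_evenProd hq n).mul (isUnit_oddProd hq (m + 1 + n))).mul_right_cancel ?_
  have h1 := hyperCoeff_mul hq (m + 1) n
  have h2 := hyperCoeff_mul hq m n
  rw [show m + 1 + 1 + n = m + 1 + n + 1 by ring, oddProd_succ, show m + 1 + n = m + n + 1 by ring,
    evenProd_succ, show 2 * (m + n + 1) + 1 = 2 * m + 2 * n + 3 by ring,
    show 2 * (m + n) + 2 = 2 * m + 2 * n + 2 by ring] at h1
  rw [show m + 1 + n = m + n + 1 by ring] at h2 ⊢
  linear_combination h1 - (1 - q ^ (2 * m + 2 * n + 2)) * h2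

lemma hyperCoeff_succ_right {q : A} (hq : IsNilpotent q) (m n : ℕ) :
    hyperCoeff q (m + 1) n * (1 + q ^ (2 * n + 1)) =
      hyperCoeff q m (n + 1) * (1 - q ^ (2 * n + 2)) := by
  refine ((isUnit_evenProd hq n).mul (isUnit_oddProd hq (m + 1 + n + 1))).mul_right_cancel ?_
  have h1 := hyperCoeff_mul hq (m + 1) n
  have h2 := hyperCoeff_mul hq m (n + 1)
  rw [oddProd_succ q n, evenProd_succ q n, ← add_assoc, ← add_assoc] at h2
  rw [show m + 1 + 1 + n = m + 1 + n + 1 by ring, show m + 1 + n = m + n + 1 by ring] at h1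
  rw [show m + 1 + n = m + n + 1 by ring] at h2 ⊢
  linear_combination (1 + q ^ (2 * n + 1)) * h1 - h2

lemma hyperCoeff_zero_left {q : A} (hq : IsNilpotent q) (n : ℕ) :
    hyperCoeff q 0 n * (1 + q ^ (2 * n + 1)) = 1 := by
  refine ((isUnit_evenProd hq n).mul (isUnit_oddProd hq n)).mul_right_cancel ?_
  have h1 := hyperCoeff_mul hq 0 n
  rw [show 0 + 1 + n = n + 1 by ring, oddProd_succ, zero_add] at h1
  linear_combination h1

lemma hyperCoeff_zero_right {q : A} (m : ℕ) :
    hyperCoeff q m 0 = evenProd q m * Ring.inverse (oddProd q (m + 1)) := by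
  simp [hyperCoeff, oddProd, evenProd]

/-- The `n`-th summand of the basic hypergeometric sum `hyperSum`. -/
noncomputable def hyperTerm (q : A) (k i m n : ℕ) : A :=
  (-1) ^ n * q ^ (2 * k * n ^ 2 + 2 * m * k * n + n + 2 * (k - i) * n) *
    (1 - q ^ (2 * i * (m + 1 + 2 * n))) * hyperCoeff q m n

/-- The truncation to `N` terms of Andrews' function `H_{k,i}(-q⁻¹; q^{2m+2}; q²)`, divided by the
infinite product `(-q; q²)_∞ / (q²; q²)_∞`. -/
noncomputable def hyperSum (q : A) (N k i m : ℕ) : A := ∑ n ∈ range N, hyperTerm q k i m n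

/-- The truncation of Andrews' function `J_{k,b+1}(-q⁻¹; q^{2m}; q²)`, divided by the
infinite product `(-q; q²)_∞ / (q²; q²)_∞`. -/
noncomputable def hyperJ (q : A) (N k b m : ℕ) : A :=
  hyperSum q N k (b + 1) m + q ^ (2 * m + 1) * hyperSum q N k b m

lemma hyperSum_zero (q : A) (N k m : ℕ) : hyperSum q N k 0 m = 0 := by
  simp [hyperSum, hyperTerm]

/-- Certificate for `hyperSum_sub`: the right side is F (n+1) - F n, where F 0 = 0 because of the
factor 1 - q^(2n), and F N = 0 because the exponent of q is at least N. -/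
lemma hyperTerm_telescope {q : A} (hq : IsNilpotent q) (c d m n : ℕ) :
    q ^ (2 * (m + 1) * c) * (hyperTerm q (c + 1 + d) (d + 1) (m + 1) n +
        q ^ (2 * (m + 1) + 1) * hyperTerm q (c + 1 + d) d (m + 1) n) -
      (hyperTerm q (c + 1 + d) (c + 1) m n - hyperTerm q (c + 1 + d) c m n) =
    (-1) ^ (n + 1) * q ^ (2 * (c + 1 + d) * (n + 1) ^ 2 + 2 * m * (c + 1 + d) * (n + 1) + (n + 1)
      + 2 * d * (n + 1)) * (1 - q ^ (2 * (n + 1))) * hyperCoeff q m (n + 1) -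
    (-1) ^ n * q ^ (2 * (c + 1 + d) * n ^ 2 + 2 * m * (c + 1 + d) * n + n
      + 2 * d * n) * (1 - q ^ (2 * n)) * hyperCoeff q m n := by
  have h1 := hyperCoeff_succ_left hq m n
  have h2 := hyperCoeff_succ_right hq m n
  unfold hyperTerm
  rw [show c + 1 + d - (d + 1) = c by omega, show c + 1 + d - d = c + 1 by omega,
    show c + 1 + d - (c + 1) = d by omega, show c + 1 + d - c = d + 1 by omega]
  linear_combination (exp := 1)
    (-1) ^ n * q ^ (2 * (c + 1 + d) * n ^ 2 + 2 * m * (c + 1 + d) * n + n +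
      2 * d * n + 2 * n + 2 * c * (m + 1 + 2 * n)) * h1 -
    (-1) ^ n * q ^ (2 * (c + 1 + d) * (n + 1) ^ 2 + 2 * m * (c + 1 + d) * (n + 1) + (n + 1)
      + 2 * d * (n + 1)) * h2

lemma hyperSum_sub {q : A} {N : ℕ} (hq : q ^ N = 0) (c d m : ℕ) :
    hyperSum q N (c + 1 + d) (c + 1) m - hyperSum q N (c + 1 + d) c m =
      q ^ (2 * (m + 1) * c) * hyperJ q N (c + 1 + d) d (m + 1) := by
  have hnil : IsNilpotent q := ⟨N, hq⟩
  symm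
  rw [← sub_eq_zero]
  unfold hyperJ hyperSum
  rw [mul_sum, ← sum_add_distrib, mul_sum, ← sum_sub_distrib, ← sum_sub_distrib]
  rw [sum_congr rfl fun n _ => hyperTerm_telescope hnil c d m n]
  rw [sum_range_sub (fun n => (-1) ^ n * q ^ (2 * (c + 1 + d) * n ^ 2 + 2 * m * (c + 1 + d) * n + n
      + 2 * d * n) * (1 - q ^ (2 * n)) * hyperCoeff q m n)]
  rw [pow_eq_zero_of_le (m := N) (by omega) hq]
  simp

lemma hyperJ_zero {q : A} {N : ℕ} (hq : q ^ N = 0) (K m : ℕ) :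
    hyperJ q N (K + 1) 0 m = hyperJ q N (K + 1) K (m + 1) := by
  have h := hyperSum_sub hq 0 K m
  rw [show 0 + 1 + K = K + 1 by ring] at h
  rw [hyperSum_zero] at h
  rw [hyperJ, hyperSum_zero]
  simpa using h

/-- J combines two adjacent sums, so its increment in b is two instances of `hyperSum_sub`. -/
lemma hyperJ_succ {q : A} {N : ℕ} (hq : q ^ N = 0) (c d m : ℕ) :
    hyperJ q N (c + 1 + d + 1) (c + 1) m = hyperJ q N (c + 1 + d + 1) c m +
      q ^ (2 * (m + 1) * (c + 1)) * hyperJ q N (c + 1 + d + 1) d (m + 1) +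
      q ^ (2 * (m + 1) * c + 2 * m + 1) * hyperJ q N (c + 1 + d + 1) (d + 1) (m + 1) := by
  have h1 := hyperSum_sub hq (c + 1) d m
  have h2 := hyperSum_sub hq c (d + 1) m
  rw [show c + 1 + 1 + d = c + 1 + d + 1 by ring] at h1
  rw [← add_assoc] at h2
  rw [hyperJ, hyperJ]
  linear_combination h1 + q ^ (2 * m + 1) * h2

/-- Every summand with n > 0 carries a power of q beyond N, and the products in the summand n = 0
have stabilised. -/
lemma hyperSum_of_le {q : A} {N : ℕ} (hq : q ^ N = 0) (hN : 0 < N) {k i m : ℕ} (hk : 0 < k)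
    (hi : 0 < i) (hm : N ≤ m) :
    hyperSum q N k i m = evenProd q N * Ring.inverse (oddProd q N) := by
  rw [hyperSum, sum_eq_single_of_mem 0 (by simpa using hN)]
  · have : q ^ (2 * i * (m + 1)) = 0 := pow_eq_zero_of_le (by nlinarith) hq
    simp [hyperTerm, this, hyperCoeff_zero_right, oddProd_of_le hq (show N ≤ m + 1 by omega),
      evenProd_of_le hq hm]
  · intro n _ hn
    have hn' : 1 ≤ n := by omega
    have : N ≤ m * k * n := hm.trans (by nlinarith [Nat.mul_le_mul hk hn'])
    rw [hyperTerm, pow_eq_zero_of_le (m := N) (by nlinarith) hq]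
    simp

lemma hyperJ_of_le {q : A} {N : ℕ} (hq : q ^ N = 0) (hN : 0 < N) {k b m : ℕ} (hk : 0 < k)
    (hm : N ≤ m) :
    hyperJ q N k b m = evenProd q N * Ring.inverse (oddProd q N) := by
  rw [hyperJ, hyperSum_of_le hq hN hk (by omega) hm, pow_eq_zero_of_le (by omega) hq]
  simp

/-- The truncation to `N` terms of the theta series
`∑ n ∈ ℤ, (-1)ⁿ q^{2kn² + (2k-2b-1)n}`. -/
def thetaSum (q : A) (N k b : ℕ) : A :=
  ∑ n ∈ range N, (-1) ^ n * q ^ (2 * k * n ^ 2 + n + 2 * (k - (b + 1)) * n) *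
    (1 - q ^ ((2 * b + 1) * (2 * n + 1)))

/-- With y = q^(2n+1), the coefficient at m = 0 is 1/(1 + y), which cancels against (1 - y^(2b+2)) +
y (1 - y^(2b)) = (1 + y)(1 - y^(2b+1)). -/
lemma hyperJ_eq_thetaSum {q : A} {N : ℕ} (hq : q ^ N = 0) (b d : ℕ) :
    hyperJ q N (b + 1 + d) b 0 = thetaSum q N (b + 1 + d) b := by
  unfold hyperJ hyperSum thetaSum
  rw [mul_sum, ← sum_add_distrib]
  refine sum_congr rfl fun n _ => ?_
  have h := hyperCoeff_zero_left ⟨N, hq⟩ n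
  unfold hyperTerm
  rw [show b + 1 + d - (b + 1) = d by omega, show b + 1 + d - b = d + 1 by omega]
  linear_combination (-1) ^ n * q ^ (2 * (b + 1 + d) * n ^ 2 + n + 2 * d * n) *
    (1 - q ^ ((2 * b + 1) * (2 * n + 1))) * h

/-- The recurrences that characterise the Göllnitz–Gordon generating functions. -/
structure IsGGSystem (q : A) (N K : ℕ) (R : ℕ → ℕ → A) : Prop where
  zero : ∀ m, R m 0 = R (m + 1) K
  succ : ∀ m c d, c + 1 + d = K → R m (c + 1) = R m c + q ^ (2 * (m + 1) * (c + 1)) * R (m + 1) d +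
    q ^ (2 * (m + 1) * c + 2 * m + 1) * R (m + 1) (d + 1)
  of_le : ∀ m b, N ≤ m → R m b = 1

/-- The recurrences reduce level m to level m + 1, and both sides agree once m ≥ N; j bounds the
distance still to climb. Within a level, induction on b. -/
lemma IsGGSystem.mul_eq_hyperJ {q : A} {N K : ℕ} {R : ℕ → ℕ → A} (h : IsGGSystem q N K R)
    (hq : q ^ N = 0) (hN : 0 < N) (j : ℕ) :
    ∀ m, N ≤ m + j → ∀ b ≤ K, R m b * (evenProd q N * Ring.inverse (oddProd q N)) =
      hyperJ q N (K + 1) b m := by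
  induction j with
  | zero =>
    intro m hm b _
    rw [h.of_le m b hm, hyperJ_of_le hq hN (by omega) (by omega), one_mul]
  | succ j ih =>
    intro m hm b hb
    have ih' := ih (m + 1) (by omega)
    induction b with
    | zero => rw [h.zero, hyperJ_zero hq, ih' K le_rfl]
    | succ c ihc =>
      obtain ⟨d, rfl⟩ := Nat.exists_eq_add_of_le hb
      rw [h.succ m c d rfl, hyperJ_succ hq, ← ihc (by omega), ← ih' d (by omega),
        ← ih' (d + 1) (by omega)]
      ring

lemma IsGGSystem.mul_eq_thetaSum {q : A} {N K : ℕ} {R : ℕ → ℕ → A} (h : IsGGSystem q N K R)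
    (hq : q ^ N = 0) (hN : 0 < N) {b : ℕ} (hb : b ≤ K) :
    R 0 b * (evenProd q N * Ring.inverse (oddProd q N)) = thetaSum q N (K + 1) b := by
  obtain ⟨d, rfl⟩ := Nat.exists_eq_add_of_le hb
  rw [h.mul_eq_hyperJ hq hN N 0 (by omega) b hb, show b + d + 1 = b + 1 + d by ring,
    hyperJ_eq_thetaSum hq]

/-- This replaces the triple product: for K = 0 the `succ` recurrence is vacuous, so the constant 1
is a system. -/
lemma thetaSum_one {q : A} {N : ℕ} (hq : q ^ N = 0) (hN : 0 < N) :
    thetaSum q N 1 0 = evenProd q N * Ring.inverse (oddProd q N) := by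
  have h : IsGGSystem q N 0 fun _ _ => (1 : A) := ⟨by simp, by omega, by simp⟩
  simpa using (h.mul_eq_thetaSum hq hN le_rfl).symm

lemma thetaSum_middle (q : A) (N s : ℕ) :
    thetaSum q N (2 * s + 1) s = thetaSum (q ^ (2 * s + 1)) N 1 0 := by
  refine sum_congr rfl fun n _ => ?_
  rw [show 2 * s + 1 - (s + 1) = s by omega]
  simp only [← pow_mul]
  ring_nf

/-! ### Product side -/

/-- The finite product `∏ (1 - qⁱ)` over the positive `i ≤ n` with `i ≢ 2 [MOD 4]`. -/
def ggProd (q : A) (n : ℕ) : A :=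
  ∏ i ∈ range n, if (i + 1) % 4 ≠ 2 then 1 - q ^ (i + 1) else 1

/-- The odd factors pair as (1 - q^(2j+1))(1 + q^(2j+1)) = 1 - q^(4j+2), and the multiples of 4
together with the numbers 4j+2 make up all even exponents. -/
lemma ggProd_mul_oddProd (q : A) (n : ℕ) :
    ggProd q (4 * n) * oddProd q (2 * n) * ∏ j ∈ range n, (1 - q ^ (4 * j + 2)) =
      evenProd q (2 * n) * ∏ j ∈ range (2 * n), (1 - q ^ (4 * j + 2)) := by
  induction n with
  | zero => simp [ggProd, oddProd, evenProd]
  | succ n ih =>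
    have h1 : ggProd q (4 * (n + 1)) = ggProd q (4 * n) *
        ((1 - q ^ (4 * n + 1)) * (1 - q ^ (4 * n + 3)) * (1 - q ^ (4 * n + 4))) := by
      unfold ggProd
      rw [show 4 * (n + 1) = 4 * n + 1 + 1 + 1 + 1 by ring, prod_range_succ, prod_range_succ,
        prod_range_succ, prod_range_succ, if_pos (by omega), if_neg (by omega), if_pos (by omega),
        if_pos (by omega)]
      ring
    rw [h1, show 2 * (n + 1) = 2 * n + 1 + 1 by ring, oddProd_succ, oddProd_succ, evenProd_succ,
      evenProd_succ, prod_range_succ, prod_range_succ, prod_range_succ]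
    linear_combination ((1 - q ^ (4 * n + 1)) * (1 - q ^ (4 * n + 3)) * (1 - q ^ (4 * n + 4)) *
      (1 + q ^ (4 * n + 1)) * (1 + q ^ (4 * n + 3)) * (1 - q ^ (4 * n + 2))) * ih

lemma ggProd_eq {q : A} {N : ℕ} (hq : q ^ N = 0) :
    ggProd q (4 * N) = evenProd q N * Ring.inverse (oddProd q N) := by
  have hnil : IsNilpotent q := ⟨N, hq⟩
  have hu : IsUnit (∏ j ∈ range N, (1 - q ^ (4 * j + 2))) :=
    IsUnit.prod_iff.2 fun j _ => isUnit_one_sub_pow hnil _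
  have h := ggProd_mul_oddProd q N
  rw [two_mul, prod_range_add, prod_eq_one (s := range N) (f := fun x => 1 - q ^ (4 * (N + x) + 2)),
    mul_one, oddProd_of_le hq (show N ≤ N + N by omega),
    evenProd_of_le hq (show N ≤ N + N by omega)] at h
  · rw [← hu.mul_right_cancel h, mul_assoc, Ring.mul_inverse_cancel _ (isUnit_oddProd hnil N),
      mul_one]
  · intro x _
    rw [pow_eq_zero_of_le (by omega) hq, sub_zero]

lemma ggProd_of_le {q : A} {N : ℕ} (hq : q ^ N = 0) {n : ℕ} (hn : N ≤ n) :
    ggProd q n = ggProd q N := by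
  induction n, hn using Nat.le_induction with
  | base => rfl
  | succ n hn ih =>
    have h : ggProd q (n + 1) = ggProd q n * _ := prod_range_succ _ _
    rw [h, ih, pow_eq_zero_of_le (by omega) hq]
    simp

lemma isUnit_ggProd {q : A} (hq : IsNilpotent q) (n : ℕ) : IsUnit (ggProd q n) := by
  refine IsUnit.prod_iff.2 fun j _ => ?_
  split_ifs
  · exact isUnit_one_sub_pow hq _
  · exact isUnit_one

/-- A Göllnitz–Gordon system with middle index is a quotient of products. -/
theorem IsGGSystem.mul_ggProd {q : A} {N s : ℕ} {R : ℕ → ℕ → A} (h : IsGGSystem q N (2 * s) R)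
    (hq : q ^ N = 0) (hN : 0 < N) :
    R 0 s * ggProd q (4 * N) = ggProd (q ^ (2 * s + 1)) (4 * N) := by
  have hq' : (q ^ (2 * s + 1)) ^ N = 0 := by
    rw [← pow_mul, mul_comm, pow_mul, hq, zero_pow (by omega)]
  rw [ggProd_eq hq, ggProd_eq hq', h.mul_eq_thetaSum hq hN (by omega), thetaSum_middle,
    thetaSum_one hq' hN]

end Algebra

/-! ### Generating functions of sets of multisets -/

section GeneratingFunction

/-- The generating function of a set of multisets by the sum of their elements. -/
noncomputable def multisetGF (S : Set (Multiset ℕ)) : PowerSeries ℤ :=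
  PowerSeries.mk fun n => ((S ∩ {s | s.sum = n}).ncard : ℤ)

lemma finite_inter_sum_eq {S : Set (Multiset ℕ)} (hS : ∀ s ∈ S, 0 ∉ s) (n : ℕ) :
    (S ∩ {s | s.sum = n}).Finite := by
  refine (Set.finite_range fun p : Nat.Partition n => p.parts).subset ?_
  rintro s ⟨hs, hn⟩
  exact ⟨⟨s, fun {i} hi => Nat.pos_of_ne_zero fun h => hS s hs (h ▸ hi), hn⟩, rfl⟩

lemma multisetGF_union {S T : Set (Multiset ℕ)} (hS : ∀ s ∈ S, 0 ∉ s) (hT : ∀ s ∈ T, 0 ∉ s)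
    (h : Disjoint S T) : multisetGF (S ∪ T) = multisetGF S + multisetGF T := by
  ext n
  simp only [multisetGF, PowerSeries.coeff_mk, map_add]
  rw [Set.union_inter_distrib_right, Set.ncard_union_eq
    (h.mono Set.inter_subset_left Set.inter_subset_left) (finite_inter_sum_eq hS n)
    (finite_inter_sum_eq hT n)]
  push_cast
  rfl

lemma multisetGF_image_add (S : Set (Multiset ℕ)) (c : Multiset ℕ) :
    multisetGF ((fun s => s + c) '' S) = PowerSeries.X ^ c.sum * multisetGF S := by
  ext n
  rw [PowerSeries.coeff_X_pow_mul']
  simp only [multisetGF, PowerSeries.coeff_mk]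
  split_ifs with hc
  · rw [← Set.ncard_image_of_injective (S ∩ {s | s.sum = n - c.sum}) (add_left_injective c)]
    congr 2
    ext s
    constructor
    · rintro ⟨⟨s, hs, rfl⟩, h⟩
      have h' : s.sum + c.sum = n := (Multiset.sum_add s c).symm.trans h
      exact ⟨s, ⟨hs, show s.sum = n - c.sum by omega⟩, rfl⟩
    · rintro ⟨s, ⟨hs, h⟩, rfl⟩
      have h' : s.sum = n - c.sum := h
      exact ⟨⟨s, hs, rfl⟩, (Multiset.sum_add s c).trans (by omega)⟩
  · have : (fun s => s + c) '' S ∩ {s | s.sum = n} = ∅ := by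
      refine Set.eq_empty_iff_forall_notMem.2 ?_
      rintro _ ⟨⟨s, -, rfl⟩, h⟩
      have h' : s.sum + c.sum = n := (Multiset.sum_add s c).symm.trans h
      omega
    simp [this]

end GeneratingFunction

/-! ### Recurrences for the Göllnitz–Gordon multisets -/

/-- Multisets of integers `> 2m` without repeated odd elements, with at most `K` elements in
each `{2a, 2a+1, 2a+2}`, and at most `b` elements in `{2m+1, 2m+2}`. -/
def ggSet (K m b : ℕ) : Set (Multiset ℕ) :=
  {s | (∀ x ≤ 2 * m, s.count x = 0) ∧ (∀ a, s.count (2 * a + 1) ≤ 1) ∧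
    (∀ a, s.count (2 * a) + s.count (2 * a + 1) + s.count (2 * a + 2) ≤ K) ∧
    s.count (2 * m + 1) + s.count (2 * m + 2) ≤ b}

lemma zero_notMem_of_mem_ggSet {K m b : ℕ} : ∀ s ∈ ggSet K m b, 0 ∉ s :=
  fun _ hs => Multiset.count_eq_zero.1 (hs.1 0 (by omega))

lemma ggSet_zero (K m : ℕ) : ggSet K m 0 = ggSet K (m + 1) K := by
  ext s
  constructor
  · rintro ⟨h1, h2, h3, h4⟩
    refine ⟨fun x hx => ?_, h2, h3, ?_⟩
    · obtain h | rfl | rfl : x ≤ 2 * m ∨ x = 2 * m + 1 ∨ x = 2 * m + 2 := by omega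
      · exact h1 x h
      · omega
      · omega
    · have := h3 (m + 1)
      rw [show 2 * (m + 1) = 2 * m + 2 by ring] at *
      omega
  · rintro ⟨h1, h2, h3, h4⟩
    refine ⟨fun x hx => h1 x (by omega), h2, h3, ?_⟩
    rw [h1 (2 * m + 1) (by omega), h1 (2 * m + 2) (by omega)]

/-- `c` copies of `2m+2`. -/
def evenBlock (m c : ℕ) : Multiset ℕ := Multiset.replicate c (2 * m + 2)

/-- `c` copies of `2m+2` and one copy of `2m+1`. -/
def oddBlock (m c : ℕ) : Multiset ℕ := Multiset.replicate c (2 * m + 2) + {2 * m + 1}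

lemma count_evenBlock (m c x : ℕ) :
    (evenBlock m c).count x = if x = 2 * m + 2 then c else 0 := by
  simp [evenBlock, Multiset.count_replicate, eq_comm]

lemma count_oddBlock (m c x : ℕ) : (oddBlock m c).count x =
    (if x = 2 * m + 2 then c else 0) + if x = 2 * m + 1 then 1 else 0 := by
  simp [oddBlock, Multiset.count_replicate, Multiset.count_singleton, eq_comm]

lemma add_evenBlock_mem_ggSet {m c d : ℕ} {s : Multiset ℕ} :
    s + evenBlock m (c + 1) ∈ ggSet (c + 1 + d) m (c + 1) ↔ s ∈ ggSet (c + 1 + d) (m + 1) d := by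
  simp only [ggSet, Set.mem_ofPred_eq, Multiset.count_add, count_evenBlock]
  constructor
  · rintro ⟨h1, h2, h3, h4⟩
    have h5 := h3 (m + 1)
    rw [show 2 * (m + 1) = 2 * m + 2 by ring] at *
    simp only [show 2 * m + 2 + 1 ≠ 2 * m + 2 by omega, show 2 * m + 2 + 2 ≠ 2 * m + 2 by omega,
      if_true, if_false, show 2 * m + 1 ≠ 2 * m + 2 by omega] at h4 h5
    refine ⟨fun x hx => ?_, fun a => ?_, fun a => ?_, ?_⟩
    · obtain h | rfl | rfl : x ≤ 2 * m ∨ x = 2 * m + 1 ∨ x = 2 * m + 2 := by omega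
      · have := h1 x h
        omega
      · omega
      · omega
    · have := h2 a
      omega
    · have := h3 a
      omega
    · omega
  · rintro ⟨h1, h2, h3, h4⟩
    rw [show 2 * (m + 1) = 2 * m + 2 by ring] at *
    refine ⟨fun x hx => ?_, fun a => ?_, fun a => ?_, ?_⟩
    · rw [h1 x (by omega), if_neg (by omega)]
    · rw [if_neg (by omega)]
      exact h2 a
    · have h3a := h3 a
      obtain rfl | rfl | h : a = m ∨ a = m + 1 ∨ (2 * a ≠ 2 * m + 2 ∧ 2 * a + 2 ≠ 2 * m + 2) := by
        omega
      · rw [h1 (2 * a) (by omega), h1 (2 * a + 1) (by omega), h1 (2 * a + 2) (by omega)]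
        simp
      · rw [show 2 * (m + 1) = 2 * m + 2 by ring, h1 (2 * m + 2) (by omega)]
        simp
        omega
      · rw [if_neg h.1, if_neg h.2, if_neg (by omega)]
        omega
    · rw [h1 (2 * m + 1) (by omega), h1 (2 * m + 2) (by omega)]
      simp

lemma add_oddBlock_mem_ggSet {m c d : ℕ} {s : Multiset ℕ} :
    s + oddBlock m c ∈ ggSet (c + 1 + d) m (c + 1) ↔ s ∈ ggSet (c + 1 + d) (m + 1) (d + 1) := by
  simp only [ggSet, Set.mem_ofPred_eq, Multiset.count_add, count_oddBlock]
  constructor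
  · rintro ⟨h1, h2, h3, h4⟩
    have h5 := h3 (m + 1)
    rw [show 2 * (m + 1) = 2 * m + 2 by ring] at *
    simp only [show 2 * m + 2 + 1 ≠ 2 * m + 2 by omega, show 2 * m + 2 + 2 ≠ 2 * m + 2 by omega,
      show 2 * m + 2 + 1 ≠ 2 * m + 1 by omega, show 2 * m + 2 + 2 ≠ 2 * m + 1 by omega,
      show 2 * m + 2 ≠ 2 * m + 1 by omega,
      if_true, if_false, show 2 * m + 1 ≠ 2 * m + 2 by omega] at h4 h5
    refine ⟨fun x hx => ?_, fun a => ?_, fun a => ?_, ?_⟩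
    · obtain h | rfl | rfl : x ≤ 2 * m ∨ x = 2 * m + 1 ∨ x = 2 * m + 2 := by omega
      · have := h1 x h
        omega
      · omega
      · omega
    · have := h2 a
      omega
    · have := h3 a
      omega
    · omega
  · rintro ⟨h1, h2, h3, h4⟩
    rw [show 2 * (m + 1) = 2 * m + 2 by ring] at *
    refine ⟨fun x hx => ?_, fun a => ?_, fun a => ?_, ?_⟩
    · rw [h1 x (by omega), if_neg (by omega), if_neg (by omega)]
    · rw [if_neg (by omega), zero_add]
      obtain rfl | h : a = m ∨ a ≠ m := eq_or_ne a m
      · rw [h1 (2 * a + 1) (by omega), if_pos rfl]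
      · rw [if_neg (by omega)]
        exact h2 a
    · have h3a := h3 a
      obtain rfl | rfl | h : a = m ∨ a = m + 1 ∨ (2 * a ≠ 2 * m + 2 ∧ 2 * a + 2 ≠ 2 * m + 2) := by
        omega
      · rw [h1 (2 * a) (by omega), h1 (2 * a + 1) (by omega), h1 (2 * a + 2) (by omega)]
        simp
        omega
      · rw [show 2 * (m + 1) = 2 * m + 2 by ring, h1 (2 * m + 2) (by omega)]
        simp
        omega
      · rw [if_neg h.1, if_neg h.2, if_neg (by omega), if_neg (by omega), if_neg (by omega),
          if_neg (by omega)]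
        omega
    · rw [h1 (2 * m + 1) (by omega), h1 (2 * m + 2) (by omega)]
      simp
      omega

/-- If exactly c + 1 elements lie in {2m+1, 2m+2}, the odd one occurs zero times or once. The window
{2m+2, 2m+3, 2m+4} then leaves room for d or d + 1 elements in {2m+3, 2m+4}. -/
lemma ggSet_succ (m c d : ℕ) : ggSet (c + 1 + d) m (c + 1) = ggSet (c + 1 + d) m c ∪
    ((fun s => s + evenBlock m (c + 1)) '' ggSet (c + 1 + d) (m + 1) d ∪
      (fun s => s + oddBlock m c) '' ggSet (c + 1 + d) (m + 1) (d + 1)) := by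
  ext s
  constructor
  · intro hs
    have ⟨h1, h2, h3, h4⟩ := hs
    obtain h | h := Nat.le_succ_iff.1 h4
    · exact Or.inl ⟨h1, h2, h3, h⟩
    obtain h0 | h0 := Nat.le_one_iff_eq_zero_or_eq_one.1 (h2 m)
    · have : evenBlock m (c + 1) ≤ s := by
        rw [Multiset.le_iff_count]
        intro x
        rw [count_evenBlock]
        split_ifs with hx
        · subst hx; omega
        · omega
      refine Or.inr (Or.inl ⟨s - evenBlock m (c + 1), ?_, Multiset.sub_add_cancel this⟩)
      rw [← add_evenBlock_mem_ggSet, Multiset.sub_add_cancel this]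
      exact hs
    · have : oddBlock m c ≤ s := by
        rw [Multiset.le_iff_count]
        intro x
        rw [count_oddBlock]
        split_ifs with hx hx' hx'
        · omega
        · subst hx; omega
        · subst hx'; omega
        · omega
      refine Or.inr (Or.inr ⟨s - oddBlock m c, ?_, Multiset.sub_add_cancel this⟩)
      rw [← add_oddBlock_mem_ggSet, Multiset.sub_add_cancel this]
      exact hs
  · rintro (⟨h1, h2, h3, h4⟩ | ⟨s, hs, rfl⟩ | ⟨s, hs, rfl⟩)
    · exact ⟨h1, h2, h3, by omega⟩
    · exact add_evenBlock_mem_ggSet.2 hs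
    · exact add_oddBlock_mem_ggSet.2 hs

lemma multisetGF_ggSet_succ (m c d : ℕ) :
    multisetGF (ggSet (c + 1 + d) m (c + 1)) = multisetGF (ggSet (c + 1 + d) m c) +
      PowerSeries.X ^ (2 * (m + 1) * (c + 1)) * multisetGF (ggSet (c + 1 + d) (m + 1) d) +
      PowerSeries.X ^ (2 * (m + 1) * c + 2 * m + 1) *
        multisetGF (ggSet (c + 1 + d) (m + 1) (d + 1)) := by
  have hsucc := ggSet_succ m c d
  have h0 : ∀ s ∈ ggSet (c + 1 + d) m (c + 1), 0 ∉ s := zero_notMem_of_mem_ggSet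
  rw [hsucc] at h0
  rw [hsucc, multisetGF_union zero_notMem_of_mem_ggSet (fun s hs => h0 s (Or.inr hs)),
    multisetGF_union (fun s hs => h0 s (Or.inr (Or.inl hs)))
      (fun s hs => h0 s (Or.inr (Or.inr hs))), multisetGF_image_add, multisetGF_image_add,
    ← add_assoc]
  · congr 3
    · simp [evenBlock]; ring
    · simp [oddBlock]; ring
  -- The multiplicity of 2m+1 is 0 on one side and 1 on the other.
  · rw [Set.disjoint_left]
    rintro _ ⟨s, hs, rfl⟩ ⟨s', hs', h⟩
    have h := congrArg (Multiset.count (2 * m + 1)) h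
    simp [count_evenBlock, count_oddBlock, hs.1 (2 * m + 1) (by omega)] at h
  · rw [Set.disjoint_left]
    rintro _ ⟨-, -, -, h⟩ (⟨s, hs, rfl⟩ | ⟨s, hs, rfl⟩) <;>
    · simp [count_evenBlock, count_oddBlock, hs.1 (2 * m + 1) (by omega)] at h
      omega

lemma coeff_multisetGF_ggSet_of_lt {K m b n : ℕ} (hn : n ≤ 2 * m) :
    PowerSeries.coeff n (multisetGF (ggSet K m b)) = PowerSeries.coeff n (1 : PowerSeries ℤ) := by
  have h : ∀ s ∈ ggSet K m b ∩ {s | s.sum = n}, s = 0 := by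
    rintro s ⟨hs, rfl⟩
    refine Multiset.eq_zero_of_forall_notMem fun x hx => ?_
    exact Multiset.count_ne_zero.2 hx (hs.1 x ((Multiset.single_le_sum (by simp) x hx).trans hn))
  rw [PowerSeries.coeff_one, multisetGF, PowerSeries.coeff_mk]
  split_ifs with h0
  · subst h0
    have : ggSet K m b ∩ {s | s.sum = 0} = {0} := by
      refine Set.eq_singleton_iff_unique_mem.2 ⟨⟨?_, by simp⟩, h⟩
      simp [ggSet]
    rw [this]
    simp
  · have : ggSet K m b ∩ {s | s.sum = n} = ∅ := by
      refine Set.eq_empty_iff_forall_notMem.2 fun s hs => h0 ?_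
      rw [← hs.2, h s hs]
      rfl
    simp [this]

/-! ### Truncation modulo X^N -/

/-- Truncation of power series to degree `< N`, as a ring homomorphism. -/
noncomputable abbrev truncHom (N : ℕ) :
    PowerSeries ℤ →+* PowerSeries ℤ ⧸ Ideal.span {(PowerSeries.X : PowerSeries ℤ) ^ N} :=
  Ideal.Quotient.mk _

lemma truncHom_eq_iff {N : ℕ} {f g : PowerSeries ℤ} :
    truncHom N f = truncHom N g ↔ ∀ n < N, PowerSeries.coeff n f = PowerSeries.coeff n g := by
  rw [Ideal.Quotient.eq, Ideal.mem_span_singleton, PowerSeries.X_pow_dvd_iff]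
  simp [sub_eq_zero]

lemma truncHom_X_pow (N : ℕ) : truncHom N PowerSeries.X ^ N = 0 := by
  rw [← map_pow, Ideal.Quotient.eq_zero_iff_mem]
  exact Ideal.mem_span_singleton_self _

lemma isGGSystem_ggSet (N K : ℕ) : IsGGSystem (truncHom N PowerSeries.X) N K
    fun m b => truncHom N (multisetGF (ggSet K m b)) where
  zero m := by rw [ggSet_zero]
  succ m c d h := by
    subst h
    rw [multisetGF_ggSet_succ]
    simp only [map_add, map_mul, map_pow]
  of_le m b hm := by
    rw [← map_one (truncHom N), truncHom_eq_iff]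
    exact fun n hn => coeff_multisetGF_ggSet_of_lt (by omega)

/-! ### Difference conditions as window counts -/

section SortedLists

variable {l : List ℕ} {lo hi K : ℕ}

/-- Positions of the selected entries increase strictly, so the K-th one is at least K places after
the first; monotonicity bounds the entry exactly K places after. -/
lemma exists_window_of_lt_countP (hl : l.Pairwise (· ≥ ·))
    (h : K < l.countP fun x => lo ≤ x ∧ x ≤ hi) :
    ∃ (j : ℕ) (hj : j + K < l.length), l[j] ≤ hi ∧ lo ≤ l[j + K] := by
  rw [List.countP_eq_length_filter] at h
  set l' := l.filter fun x => decide (lo ≤ x ∧ x ≤ hi) with hl'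
  have hsub : l'.Sublist l := List.filter_sublist
  obtain ⟨f, hf⟩ := List.sublist_iff_exists_fin_orderEmbedding_get_eq.1 hsub
  have hmem (i : Fin l'.length) : lo ≤ l[f i] ∧ l[f i] ≤ hi := by
    have h1 : l.get (f i) ∈ l' := hf i ▸ List.get_mem l' i
    simpa using List.of_mem_filter h1
  have hstep (i : ℕ) (hi : i < l'.length) : (f ⟨0, by omega⟩ : ℕ) + i ≤ f ⟨i, hi⟩ := by
    induction i with
    | zero => rfl
    | succ i ih =>
      have h1 : f ⟨i, by omega⟩ < f ⟨i + 1, hi⟩ := f.strictMono (by simp)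
      have h2 := ih (by omega)
      rw [Fin.lt_def] at h1
      omega
  have hK := hstep K h
  refine ⟨f ⟨0, by omega⟩, by omega, (hmem _).2, (hmem ⟨K, h⟩).1.trans ?_⟩
  obtain h0 | h0 := hK.eq_or_lt
  · simp [h0]
  · exact List.pairwise_iff_getElem.1 hl _ _ (by omega) (f ⟨K, h⟩).2 h0

lemma lt_countP_of_window (hl : l.Pairwise (· ≥ ·)) {j : ℕ} (hj : j + K < l.length)
    (h1 : l[j] ≤ hi) (h2 : lo ≤ l[j + K]) : K < l.countP fun x => lo ≤ x ∧ x ≤ hi := by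
  have hsub : ((l.drop j).take (K + 1)).Sublist l :=
    (List.take_sublist _ _).trans (List.drop_sublist _ _)
  refine lt_of_lt_of_le ?_ (hsub.countP_le)
  rw [List.countP_eq_length.2]
  · simp; omega
  · intro x hx
    obtain ⟨i, hi', rfl⟩ := List.getElem_of_mem hx
    have hi'' : i < K + 1 := by simp at hi'; omega
    have hget (a b : ℕ) (hab : a ≤ b) (hb : b < l.length) : l[b] ≤ l[a] := by
      obtain rfl | h := hab.eq_or_lt
      · rfl
      · exact List.pairwise_iff_getElem.1 hl _ _ _ _ h
    simp only [List.getElem_take, List.getElem_drop, decide_eq_true_eq]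
    exact ⟨h2.trans (hget _ _ (by omega) _), (hget _ _ (by omega) _).trans h1⟩

/-- A violation at l[j] = 2a+1 or l[j] = 2a+2 means l[j+K] ≥ 2a in either case, so K + 1 entries
share the window {2a, 2a+1, 2a+2}. -/
lemma window_iff_countP_le (hl : l.Pairwise (· ≥ ·)) (hpos : ∀ x ∈ l, 0 < x) :
    (∀ (j : ℕ) (h : j + K < l.length), (Odd l[j] → 2 ≤ l[j] - l[j + K]) ∧
      (Even l[j] → 2 < l[j] - l[j + K])) ↔
    ∀ a, (l.countP fun x => 2 * a ≤ x ∧ x ≤ 2 * a + 2) ≤ K := by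
  constructor
  · intro h a
    by_contra! hc
    obtain ⟨j, hj, h1, h2⟩ := exists_window_of_lt_countP hl hc
    obtain ⟨h3, h4⟩ := h j hj
    obtain he | ho := Nat.even_or_odd l[j]
    · have := h4 he
      omega
    · have := h3 ho
      obtain ⟨b, hb⟩ := ho
      omega
  · intro h j hj
    have hp := hpos _ (List.getElem_mem (show j < l.length by omega))
    constructor
    · rintro ⟨a, ha⟩
      by_contra hc
      exact absurd (lt_countP_of_window (lo := 2 * a) (hi := 2 * a + 2) hl hj (by omega) (by omega))
        (not_lt.2 (h a))
    -- Here l[j] = 2a tops the window starting at 2(a-1); positivity of l[j] makes the natural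
    -- subtraction exact.
    · rintro ⟨a, ha⟩
      by_contra hc
      exact absurd (lt_countP_of_window (lo := 2 * (a - 1)) (hi := 2 * (a - 1) + 2) hl hj (by omega)
        (by omega)) (not_lt.2 (h (a - 1)))

end SortedLists

lemma countP_window (s : Multiset ℕ) (a : ℕ) :
    (s.countP fun x => 2 * a ≤ x ∧ x ≤ 2 * a + 2) =
      s.count (2 * a) + s.count (2 * a + 1) + s.count (2 * a + 2) := by
  induction s using Multiset.induction_on with
  | empty => simp
  | cons x s ih =>
    simp only [Multiset.countP_cons, Multiset.count_cons, ih]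
    split_ifs <;> omega

lemma card_filter_le_two {s : Multiset ℕ} (hs : 0 ∉ s) :
    (s.filter fun a => a ≤ 2).card = s.count 1 + s.count 2 := by
  rw [← Multiset.countP_eq_card_filter]
  induction s using Multiset.induction_on with
  | empty => simp
  | cons x s ih =>
    simp only [Multiset.mem_cons, not_or] at hs
    simp only [Multiset.countP_cons, Multiset.count_cons, ih hs.2]
    split_ifs <;> omega

lemma isWPartition_iff {k i n : ℕ} (p : n.Partition) :
    IsWPartition k i p ↔ p.parts ∈ ggSet (k - 1) 0 (i - 1) := by
  have h0 : 0 ∉ p.parts := fun h => (p.parts_pos h).ne rfl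
  have hsort : (partsList p : Multiset ℕ) = p.parts := Multiset.sort_eq _ _
  have hwin := window_iff_countP_le (l := partsList p) (K := k - 1)
    (p.parts.pairwise_sort (· ≥ ·)) fun x hx => p.parts_pos (by rwa [← hsort])
  unfold IsWPartition
  rw [hwin, card_filter_le_two h0]
  have hc (a : ℕ) : ((partsList p).countP fun x => 2 * a ≤ x ∧ x ≤ 2 * a + 2) =
      p.parts.count (2 * a) + p.parts.count (2 * a + 1) + p.parts.count (2 * a + 2) := by
    rw [← countP_window, ← hsort, Multiset.coe_countP]
  simp only [hc, ggSet, Set.mem_ofPred_eq]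
  constructor
  · rintro ⟨h1, h2, h3⟩
    refine ⟨fun x hx => ?_, fun a => ?_, h2, h3⟩
    · obtain rfl : x = 0 := by omega
      exact Multiset.count_eq_zero.2 h0
    · by_cases ha : 2 * a + 1 ∈ p.parts
      · exact (h1 _ ha ⟨a, rfl⟩).le
      · simp [Multiset.count_eq_zero.2 ha]
  · rintro ⟨-, h1, h2, h3⟩
    refine ⟨?_, h2, h3⟩
    rintro _ ha ⟨a, rfl⟩
    exact le_antisymm (h1 a) (Multiset.one_le_count_iff_mem.2 ha)

lemma countW_eq_coeff (k i n : ℕ) :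
    (countW k i n : ℤ) = PowerSeries.coeff n (multisetGF (ggSet (k - 1) 0 (i - 1))) := by
  classical
  rw [multisetGF, PowerSeries.coeff_mk, countW, Nat.cast_inj, ← Set.ncard_coe_finset,
    ← Set.ncard_image_of_injective _ (f := fun p : n.Partition => p.parts)
      fun p q h => Nat.Partition.ext h]
  congr 1
  ext s
  constructor
  · rintro ⟨p, hp, rfl⟩
    rw [mem_coe, mem_filter, isWPartition_iff] at hp
    exact ⟨hp.2, p.parts_sum⟩
  · rintro ⟨hs, hn⟩
    refine ⟨⟨s, fun {i} hi => Nat.pos_of_ne_zero ?_, hn⟩, ?_, rfl⟩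
    · rintro rfl
      exact zero_notMem_of_mem_ggSet s hs hi
    · rw [mem_coe, mem_filter, isWPartition_iff]
      exact ⟨mem_univ _, hs⟩

/-! ### Product formulas for C and V -/

section Products

open PowerSeries PowerSeries.WithPiTopology

/-- The generating function of `countC 4 t`. -/
noncomputable def seriesC (t : ℕ) : PowerSeries ℤ := PowerSeries.mk fun n => (countC 4 t n : ℤ)

/-- The generating function of `countV t ((t + 1) / 2)`. -/
noncomputable def seriesV (t : ℕ) : PowerSeries ℤ :=
  PowerSeries.mk fun n => (countV t ((t + 1) / 2) n : ℤ)

lemma isSCongruent_four_iff {n : ℕ} (p : n.Partition) :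
    IsSCongruent 4 p ↔ ∀ a ∈ p.parts, a % 4 ≠ 2 := by
  refine forall₂_congr fun a _ => ⟨fun h => h 1 (by omega) (by omega), fun h r h0 h1 => ?_⟩
  obtain rfl : r = 1 := by omega
  exact h

lemma isVPartition_middle_iff {t n : ℕ} (ht : Odd t) (p : n.Partition) :
    IsVPartition t ((t + 1) / 2) p ↔ ∀ a ∈ p.parts, a % 4 ≠ 2 ∧ ¬ t ∣ a := by
  refine forall₂_congr fun a _ => and_congr_right fun ha => ?_
  obtain ⟨s, rfl⟩ := ht
  rw [show (2 * s + 1 + 1) / 2 = s + 1 by omega]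
  simp only [Int.modEq_iff_dvd]
  constructor
  · rintro ⟨h1, h2, h3⟩ ⟨c, rfl⟩
    obtain ⟨e, rfl | rfl | rfl | rfl⟩ : ∃ e, c = 4 * e ∨ c = 4 * e + 1 ∨ c = 4 * e + 2 ∨
        c = 4 * e + 3 := ⟨c / 4, by omega⟩
    · exact h1 ⟨-e, by push_cast; ring⟩
    · exact h2 ⟨-e, by push_cast; ring⟩
    · rw [show (2 * s + 1) * (4 * e + 2) = 4 * ((2 * s + 1) * e + s) + 2 by ring] at ha
      exact ha (Nat.mul_add_mod 4 _ 2)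
    · exact h3 ⟨-e - 1, by push_cast; ring⟩
  · intro h
    refine ⟨?_, ?_, ?_⟩ <;> rintro ⟨c, hc⟩ <;> refine h (Int.natCast_dvd_natCast.1 ?_)
    · exact ⟨-4 * c, by push_cast at *; linear_combination -hc⟩
    · exact ⟨1 - 4 * c, by push_cast at *; linear_combination -hc⟩
    · exact ⟨-1 - 4 * c, by push_cast at *; linear_combination -hc⟩

lemma hasProd_seriesC [TopologicalSpace ℤ] [DiscreteTopology ℤ] {t : ℕ} (ht : 0 < t) :
    HasProd (fun i => if (i + 1) % 4 ≠ 2 then ∑ j ∈ range t, X ^ ((i + 1) * j) else 1)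
      (seriesC t) := by
  convert! Nat.Partition.hasProd_genFun
    (fun i c => if i % 4 ≠ 2 ∧ c < t then (1 : ℤ) else 0) using 1
  · ext1 i
    split_ifs with hi
    -- The multiplicity-zero term is split off, since the factors of `genFun` are 1 plus a sum over
    -- positive multiplicities.
    · rw [sum_range_eq_add_Ico _ ht, sum_Ico_eq_sum_range]
      congrm $(by simp) + ?_
      rw [tsum_eq_sum (s := range (t - 1))]
      · refine sum_congr rfl fun b hb => ?_
        rw [mem_range] at hb
        rw [if_pos ⟨hi, by omega⟩, add_comm 1 b]
        exact (one_smul ℤ (X ^ ((i + 1) * (b + 1)) : PowerSeries ℤ)).symm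
      · intro b hb
        rw [mem_range] at hb
        rw [if_neg (by omega)]
        exact zero_smul ℤ (X ^ ((i + 1) * (b + 1)) : PowerSeries ℤ)
    · simp only [hi, false_and, if_false]
      rw [left_eq_add]
      exact (tsum_congr fun j => zero_smul ℤ (X ^ ((i + 1) * (j + 1)) : PowerSeries ℤ)).trans tsum_zero
  · classical
    simp_rw [Nat.Partition.genFun, seriesC, countC, card_filter, Finsupp.prod, prod_boole]
    ext n
    simp only [coeff_mk, Nat.cast_sum, Nat.cast_ite, Nat.cast_one, Nat.cast_zero]
    refine sum_congr rfl fun p _ => if_congr ?_ rfl rfl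
    simp [isSCongruent_four_iff, IsTDistinct, forall_and]

lemma hasProd_seriesV [TopologicalSpace ℤ] [DiscreteTopology ℤ] {t : ℕ} (ht : Odd t) :
    HasProd (fun i => if (i + 1) % 4 ≠ 2 ∧ ¬ t ∣ i + 1 then ∑' j : ℕ, X ^ ((i + 1) * j) else 1)
      (seriesV t) := by
  convert! Nat.Partition.hasProd_powerSeriesMk_card_restricted ℤ
    (fun a => a % 4 ≠ 2 ∧ ¬ t ∣ a) using 1
  classical
  ext n
  simp only [seriesV, coeff_mk, countV, Nat.Partition.restricted, isVPartition_middle_iff ht]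

/-- Coefficients below N of the partial products are constant once the index set contains `range L`.
-/
lemma truncHom_hasProd [TopologicalSpace ℤ] [DiscreteTopology ℤ] {f : ℕ → PowerSeries ℤ}
    {a : PowerSeries ℤ} (h : HasProd f a) {N L : ℕ} (hf : ∀ i, L ≤ i → truncHom N (f i) = 1) :
    truncHom N a = ∏ i ∈ range L, truncHom N (f i) := by
  rw [← map_prod, truncHom_eq_iff]
  intro n hn
  refine tendsto_nhds_unique ((tendsto_iff_coeff_tendsto _ _ _ _).1 h n)
    (tendsto_atTop_of_eventually_const (i₀ := range L) fun s hs => ?_)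
  refine truncHom_eq_iff.1 ?_ n hn
  rw [map_prod, map_prod]
  refine (prod_subset hs fun i _ hi => hf i ?_).symm
  simpa using hi

lemma truncHom_seriesC_mul {t : ℕ} (ht : 0 < t) {N L : ℕ} (hL : N ≤ L) :
    truncHom N (seriesC t) * ggProd (truncHom N X) L = ggProd (truncHom N X ^ t) L := by
  let _ : TopologicalSpace ℤ := ⊥
  have _ : DiscreteTopology ℤ := ⟨rfl⟩
  have hgeom (i : ℕ) : truncHom N (∑ j ∈ range t, X ^ ((i + 1) * j)) *
      (1 - truncHom N X ^ (i + 1)) = 1 - (truncHom N X ^ t) ^ (i + 1) := by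
    simp only [map_sum, map_pow, pow_mul]
    rw [geom_sum_mul_neg, pow_right_comm]
  rw [truncHom_hasProd (hasProd_seriesC ht) (L := L), ggProd, ggProd, ← prod_mul_distrib]
  · refine prod_congr rfl fun i _ => ?_
    split_ifs with hi
    · exact hgeom i
    · simp
  · intro i hi
    split_ifs
    · have := hgeom i
      rwa [pow_right_comm, pow_eq_zero_of_le (by omega) (truncHom_X_pow N), zero_pow ht.ne',
        sub_zero, mul_one] at this
    · simp

lemma prod_range_mul_dvd {M : Type*} [CommMonoid M] {t : ℕ} (ht : 0 < t) (f : ℕ → M) (L : ℕ) :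
    ∏ i ∈ range (t * L), (if t ∣ i + 1 then f (i + 1) else 1) =
      ∏ j ∈ range L, f (t * (j + 1)) := by
  induction L with
  | zero => simp
  | succ L ih =>
    rw [mul_add_one, prod_range_add, ih, prod_range_succ,
      prod_eq_single_of_mem (s := range t) (t - 1) (by simpa using ht)]
    · rw [add_assoc, Nat.sub_add_cancel ht, if_pos ⟨L + 1, by ring⟩]
      rfl
    · intro r hr hne
      rw [mem_range] at hr
      rw [if_neg]
      rw [add_assoc, Nat.dvd_add_right (Dvd.intro _ rfl)]
      exact fun h => by have := Nat.le_of_dvd (by omega) h; omega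

lemma odd_mul_mod_four_eq_two_iff {t : ℕ} (ht : Odd t) (a : ℕ) : t * a % 4 = 2 ↔ a % 4 = 2 := by
  obtain ⟨s, rfl⟩ := ht
  rw [Nat.mul_mod]
  obtain h | h : (2 * s + 1) % 4 = 1 ∨ (2 * s + 1) % 4 = 3 := by omega
  all_goals
    rw [h]
    omega

/-- The length t * L makes the multiples of t in range exactly t, 2t, …, tL. Their factors survive
as the right side, since multiplying by odd t preserves being ≡ 2 (mod 4) in both directions. -/
lemma truncHom_seriesV_mul {t : ℕ} (ht : Odd t) {N L : ℕ} (hL : N ≤ L) :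
    truncHom N (seriesV t) * ggProd (truncHom N X) (t * L) = ggProd (truncHom N X ^ t) L := by
  let _ : TopologicalSpace ℤ := ⊥
  have _ : DiscreteTopology ℤ := ⟨rfl⟩
  have ht0 : 0 < t := ht.pos
  have hgeom (i : ℕ) : truncHom N (∑' j : ℕ, X ^ ((i + 1) * j)) *
      (1 - truncHom N X ^ (i + 1)) = 1 := by
    rw [← map_pow, ← map_one (truncHom N), ← map_sub, ← map_mul]
    simp only [pow_mul]
    rw [tsum_pow_mul_one_sub_of_constantCoeff_eq_zero (by simp)]
  rw [truncHom_hasProd (hasProd_seriesV ht) (L := t * L), ggProd, ggProd, ← prod_mul_distrib]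
  · rw [prod_congr rfl fun i _ => ?_, prod_range_mul_dvd ht0
      (fun a => if a % 4 ≠ 2 then 1 - truncHom N X ^ a else 1)]
    · simp only [ne_eq, odd_mul_mod_four_eq_two_iff ht, pow_mul]
    · by_cases h1 : (i + 1) % 4 = 2
      · simp [h1]
      · by_cases h2 : t ∣ i + 1
        · simp [h1, h2]
        · simpa [h1, h2] using hgeom i
  · intro i hi
    split_ifs
    · have := hgeom i
      rwa [pow_eq_zero_of_le (by nlinarith) (truncHom_X_pow N), sub_zero, mul_one] at this
    · simp

end Products

end GollnitzGordon

theorem mainTheorem4 (t : ℕ) (ht : 3 ≤ t) (htodd : Odd t) (n : ℕ) :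
    countC 4 t n = countV t ((t + 1) / 2) n ∧
    countV t ((t + 1) / 2) n = countW t ((t + 1) / 2) n := by
  open GollnitzGordon in
  -- The least truncation that still sees the coefficient of degree n.
  set N := n + 1
  set q := truncHom N PowerSeries.X with hqdef
  have hq : q ^ N = 0 := truncHom_X_pow N
  have hu : IsUnit (ggProd q (4 * N)) := isUnit_ggProd ⟨N, hq⟩ _
  have hC := truncHom_seriesC_mul (t := t) (by omega) (show N ≤ 4 * N by omega)
  have hV := truncHom_seriesV_mul htodd (show N ≤ 4 * N by omega)
  rw [← hqdef] at hC hV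
  -- Beyond N all factors are 1, so the lengths t * (4 * N) and 4 * N give the same product.
  rw [ggProd_of_le hq (show N ≤ t * (4 * N) by nlinarith),
    ← ggProd_of_le hq (show N ≤ 4 * N by omega)] at hV
  obtain ⟨s, rfl⟩ := htodd
  have hW := (isGGSystem_ggSet N (2 * s)).mul_ggProd hq (Nat.succ_pos n)
  rw [show (2 * s + 1 + 1) / 2 = s + 1 by omega]
  have hCV := truncHom_eq_iff.1 (hu.mul_right_cancel (hC.trans hV.symm)) n (Nat.lt_succ_self n)
  have hVW := truncHom_eq_iff.1 (hu.mul_right_cancel (hV.trans hW.symm)) n (Nat.lt_succ_self n)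
  rw [seriesC, seriesV, PowerSeries.coeff_mk, PowerSeries.coeff_mk,
    show (2 * s + 1 + 1) / 2 = s + 1 by omega] at hCV
  have hcW := countW_eq_coeff (2 * s + 1) (s + 1) n
  rw [Nat.add_sub_cancel, Nat.add_sub_cancel] at hcW
  rw [seriesV, PowerSeries.coeff_mk, show (2 * s + 1 + 1) / 2 = s + 1 by omega, ← hcW] at hVW
  exact ⟨by exact_mod_cast hCV, by exact_mod_cast hVW⟩
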